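/- Let $n\ge 2$ and let $\Omega\subset\mathbb{R}^n$ be a compact strictly convex set with non-empty interior whose boundary $\partial\Omega$ is a $C^\infty$ hypersurface. Let $r$ be its inner radius (the supremum of the radii of closed balls contained in $\Omega$) and $R$ its outer radius (the infimum of the radii of closed balls containing $\Omega$). For $y\in\partial\Omega$ let $\lambda_{y;\partial\Omega}\in(0,\infty]$ be the maximal principal radius of curvature of $\partial\Omega$ at $y$, i.e. the largest of the reciprocals $1/\kappa$ of the principal curvatures $\kappa\ge 0$ of $\partial\Omega$ at $y$ with respect to the outer unit normal $\nu$, i.e. the eigenvalues of $d\nu_y$ on $T_y\partial\Omega$ (with $1/0=\infty$). Then, with the dimensional constant $C=4\sqrt2\,n^6$, there is a point $y\in\partial\Omega$ such that $$\lambda_{y;\partial\Omega}\ \ge\ \frac{R^2}{C\,r},$$ and consequently $$\frac{R^2}{r}\ \le\ C\,\sup_{y\in\partial\Omega}\lambda_{y;\partial\Omega}.$$ -/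

import Mathlib

open scoped ENNReal ContDiff

/-- The inner radius (inradius): the supremum of the radii of the closed balls contained in `Ω`. -/
noncomputable def innerRadius {n : ℕ} (Ω : Set (EuclideanSpace ℝ (Fin n))) : ℝ :=
  sSup {ρ : ℝ | 0 ≤ ρ ∧ ∃ c, Metric.closedBall c ρ ⊆ Ω}

/-- The outer radius (circumradius): the infimum of the radii of the closed balls containing `Ω`. -/
noncomputable def outerRadius {n : ℕ} (Ω : Set (EuclideanSpace ℝ (Fin n))) : ℝ :=
  sInf {ρ : ℝ | 0 ≤ ρ ∧ ∃ c, Ω ⊆ Metric.closedBall c ρ}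

/-- `f` is a smooth local defining function of `Ω` at the boundary point `y`: it is `C^∞` on an
open neighbourhood `U` of `y`, vanishes at `y` with nonzero differential there, and
`Ω ∩ U = {z ∈ U | f z ≤ 0}`. -/
def IsDefiningFunctionAt {n : ℕ} (Ω : Set (EuclideanSpace ℝ (Fin n)))
    (y : EuclideanSpace ℝ (Fin n)) (f : EuclideanSpace ℝ (Fin n) → ℝ) : Prop :=
  f y = 0 ∧ fderiv ℝ f y ≠ 0 ∧
    ∃ U : Set (EuclideanSpace ℝ (Fin n)), IsOpen U ∧ y ∈ U ∧ ContDiffOn ℝ ∞ f U ∧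
      ∀ z ∈ U, z ∈ Ω ↔ f z ≤ 0

/-- The boundary of `Ω` is a smooth hypersurface (with `Ω` locally on one side of it). -/
def HasSmoothBoundary {n : ℕ} (Ω : Set (EuclideanSpace ℝ (Fin n))) : Prop :=
  ∀ y ∈ frontier Ω, ∃ f, IsDefiningFunctionAt Ω y f

/-- A smooth strictly convex body: a compact strictly convex set with nonempty interior and smooth
boundary. Points of zero curvature are not excluded (the principal radius is `∞` there). -/
structure IsSmoothStrictlyConvexBody {n : ℕ} (Ω : Set (EuclideanSpace ℝ (Fin n))) : Prop where
  isCompact : IsCompact Ω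
  strictConvex : StrictConvex ℝ Ω
  nonempty_interior : (interior Ω).Nonempty
  smooth : HasSmoothBoundary Ω

/-- `κ` is a principal curvature of `∂Ω` at `y`: an eigenvalue of the Weingarten map, that is, of
the differential on the tangent space `ker Df(y)` of the outer unit normal `∇f / |∇f|`. Its
bilinear form is `D²f(y) / |∇f(y)|`, and `κ ≥ 0` for convex `Ω`. The value does not depend on the
local defining function `f`. -/
def IsPrincipalCurvature {n : ℕ} (Ω : Set (EuclideanSpace ℝ (Fin n)))
    (y : EuclideanSpace ℝ (Fin n)) (κ : ℝ) : Prop :=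
  ∃ f, IsDefiningFunctionAt Ω y f ∧
    ∃ v : EuclideanSpace ℝ (Fin n), v ≠ 0 ∧ fderiv ℝ f y v = 0 ∧
      ∀ w : EuclideanSpace ℝ (Fin n), fderiv ℝ f y w = 0 →
        fderiv ℝ (fderiv ℝ f) y v w / ‖fderiv ℝ f y‖ = κ * inner ℝ v w

/-- The maximal principal radius of curvature of `∂Ω` at `y`: the largest reciprocal `1 / κ` of
a principal curvature, with value `∞` where some principal curvature vanishes. -/
noncomputable def maxPrincipalRadius {n : ℕ} (Ω : Set (EuclideanSpace ℝ (Fin n)))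
    (y : EuclideanSpace ℝ (Fin n)) : ℝ≥0∞ :=
  ⨆ (κ : ℝ) (_ : IsPrincipalCurvature Ω y κ), (ENNReal.ofReal κ)⁻¹

/-! Fit a spindle inside the body and grow it until it touches the boundary. Let `4 L` be the
diameter. By strict convexity the middle half of a diameter, `|t| ≤ L`, lies in the interior. Around
it put the spindle `‖z‖ ≤ s (L² - t²)` with the largest `s` that keeps it inside `Ω`; it touches
`∂Ω` away from its tips (`exists_touching_spindle`). Its meridian there is a parabola inside `Ω`
with second-order coefficient `-s`, so some principal curvature is at most `2 s`
(`exists_isPrincipalCurvature_le`). The spindle also contains a ball of radius `s L² / 3`, so `s ≤ 3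
r / L²`. With `R ≤ 4 L` this gives `κ R² ≤ 96 r`, and `96 ≤ C` already for `n = 2`. -/

/-! ### Eigenvalues and second-order conditions. -/

/-- If the quadratic form of `B` is at most `c ‖v₀‖²` at some nonzero `v₀ ∈ W`, then `B` restricted
to `W` has an eigenvalue at most `c`. -/
theorem exists_eigenvector_le {E : Type*} [NormedAddCommGroup E] [InnerProductSpace ℝ E]
    [FiniteDimensional ℝ E] (B : E →L[ℝ] E →L[ℝ] ℝ) (hB : ∀ v w, B v w = B w v)
    (W : Submodule ℝ E) {c : ℝ} {v₀ : E} (hv₀ : v₀ ∈ W) (hne : v₀ ≠ 0)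
    (hc : B v₀ v₀ ≤ c * ‖v₀‖ ^ 2) :
    ∃ v ∈ W, v ≠ 0 ∧ ∃ μ ≤ c, ∀ w ∈ W, B v w = μ * inner ℝ v w := by
  have hcpt : IsCompact ((W : Set E) ∩ Metric.sphere (0 : E) 1) :=
    (isCompact_sphere 0 1).inter_left W.closed_of_finiteDimensional
  have hpos : 0 < ‖v₀‖ := norm_pos_iff.2 hne
  have hmem : ∀ w ∈ W, w ≠ 0 → ‖w‖⁻¹ • w ∈ (W : Set E) ∩ Metric.sphere (0 : E) 1 := by
    intro w hw h0
    refine ⟨W.smul_mem _ hw, ?_⟩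
    simp [norm_smul, h0]
  obtain ⟨v, ⟨hvW, hv1⟩, hmin⟩ := hcpt.exists_isMinOn ⟨_, hmem v₀ hv₀ hne⟩
    (f := fun v => B v v) (by fun_prop)
  have hv1 : ‖v‖ = 1 := by simpa using hv1
  have hge : ∀ w ∈ W, B v v * ‖w‖ ^ 2 ≤ B w w := by
    intro w hw
    rcases eq_or_ne w 0 with rfl | h0
    · simp
    have h : B v v ≤ B (‖w‖⁻¹ • w) (‖w‖⁻¹ • w) := hmin (hmem w hw h0)
    have hw0 : 0 < ‖w‖ := norm_pos_iff.2 h0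
    simp only [map_smul, smul_apply, smul_eq_mul] at h
    have h2 := mul_le_mul_of_nonneg_right h (sq_nonneg ‖w‖)
    have : ‖w‖⁻¹ * (‖w‖⁻¹ * B w w) * ‖w‖ ^ 2 = B w w := by field_simp
    linarith
  refine ⟨v, hvW, norm_pos_iff.1 (by simp [hv1]), B v v, ?_, ?_⟩
  · exact le_of_mul_le_mul_right ((hge v₀ hv₀).trans hc) (by positivity)
  · intro w hw
    -- Perturbing the minimizer to `v + x w` gives a nonnegative quadratic in `x` without constant
    -- term, so its linear coefficient vanishes.
    have hquad : ∀ x : ℝ, 0 ≤ (B w w - B v v * ‖w‖ ^ 2) * (x * x)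
        + (2 * (B v w - B v v * inner ℝ v w)) * x + 0 := by
      intro x
      have h := hge (v + x • w) (W.add_mem hvW (W.smul_mem _ hw))
      rw [norm_add_sq_real, norm_smul, inner_smul_right, hv1, mul_pow, Real.norm_eq_abs,
        sq_abs] at h
      simp only [map_add, map_smul, add_apply,
        smul_apply, smul_eq_mul, hB w v] at h
      linarith
    have h := discrim_le_zero hquad
    rw [discrim] at h
    nlinarith [sq_nonneg (B v w - B v v * inner ℝ v w)]

/-- First and second order necessary conditions for a maximum of `f` along a parabola. -/
theorem second_order_along_parabola {E : Type*} [NormedAddCommGroup E] [NormedSpace ℝ E]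
    {f : E → ℝ} {y : E} (hf : ContDiffAt ℝ 2 f y) (a b : E)
    (hmax : IsLocalMax (fun τ : ℝ => f (y + τ • a + τ ^ 2 • b)) 0) :
    fderiv ℝ f y a = 0 ∧ fderiv ℝ (fderiv ℝ f) y a a + 2 * fderiv ℝ f y b ≤ 0 := by
  set γ : ℝ → E := fun τ => y + τ • a + τ ^ 2 • b with hγ
  have hγ0 : γ 0 = y := by simp [hγ]
  have hγd : ∀ τ, HasDerivAt γ (a + (2 * τ) • b) τ := by
    intro τ
    have h1 : HasDerivAt (fun τ : ℝ => τ • a) ((1 : ℝ) • a) τ := (hasDerivAt_id τ).smul_const a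
    have h2 : HasDerivAt (fun τ : ℝ => τ ^ 2 • b) ((2 * τ) • b) τ := by
      have := (hasDerivAt_pow 2 τ).smul_const b
      simpa using this
    rw [one_smul] at h1
    exact (h1.const_add y).add h2
  have hγc : ContinuousAt γ 0 := (hγd 0).continuousAt
  have hdiff : ∀ᶠ x in nhds y, DifferentiableAt ℝ f x :=
    (hf.eventually (by simp)).mono fun x hx => hx.differentiableAt (by norm_num)
  have hgd : ∀ᶠ τ in nhds (0 : ℝ), HasDerivAt (f ∘ γ) (fderiv ℝ f (γ τ) (a + (2 * τ) • b)) τ := by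
    have : ∀ᶠ τ in nhds (0 : ℝ), DifferentiableAt ℝ f (γ τ) := by
      apply hγc.eventually
      rwa [hγ0]
    filter_upwards [this] with τ hτ
    exact hτ.hasFDerivAt.comp_hasDerivAt τ (hγd τ)
  have hd0 : deriv (f ∘ γ) 0 = fderiv ℝ f y a := by
    rw [hgd.self_of_nhds.deriv]; simp [hγ0]
  have hmax' : IsLocalMax (f ∘ γ) 0 := hmax
  have hz : fderiv ℝ f y a = 0 := by rw [← hd0]; exact hmax'.deriv_eq_zero
  refine ⟨hz, ?_⟩
  have hff : HasFDerivAt (fderiv ℝ f) (fderiv ℝ (fderiv ℝ f) y) (γ 0) := by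
    rw [hγ0]
    exact ((hf.fderiv_right (m := 1) (by norm_num)).differentiableAt (by norm_num)).hasFDerivAt
  have h2 : HasDerivAt (fun τ => fderiv ℝ f (γ τ) (a + (2 * τ) • b))
      (fderiv ℝ (fderiv ℝ f) y a a + 2 * fderiv ℝ f y b) 0 := by
    have h3 : HasDerivAt (fun τ : ℝ => a + (2 * τ) • b) ((2 : ℝ) • b) 0 := by
      have := (((hasDerivAt_id (0 : ℝ)).const_mul 2).smul_const b).const_add a
      simpa using this
    have := (hff.comp_hasDerivAt (0 : ℝ) (hγd 0)).clm_apply h3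
    simpa [hγ0] using this
  have hdd : deriv (deriv (f ∘ γ)) 0 = fderiv ℝ (fderiv ℝ f) y a a + 2 * fderiv ℝ f y b := by
    rw [← h2.deriv]
    exact Filter.EventuallyEq.deriv_eq (by filter_upwards [hgd] with τ hτ using hτ.deriv)
  -- A positive second derivative would make `0` a local minimum too, so `f ∘ γ` would be locally
  -- constant.
  by_contra! hpos
  rw [← hdd] at hpos
  have hmin := isLocalMin_of_deriv_deriv_pos hpos (hd0.trans hz)
    hgd.self_of_nhds.continuousAt
  have hconst : (f ∘ γ) =ᶠ[nhds 0] fun _ => (f ∘ γ) 0 := by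
    filter_upwards [hmin, hmax'] with τ h1 h2 using le_antisymm h2 h1
  have := hconst.deriv.deriv_eq
  rw [deriv_const', deriv_const] at this
  exact hpos.ne' this

/-! ### The touching spindle. -/

/-- The largest spindle `‖z‖ ≤ s (L² - t²)` around a segment inside `Ω` touches the frontier. -/
theorem exists_touching_spindle {E : Type*} [NormedAddCommGroup E] [InnerProductSpace ℝ E]
    {Ω : Set E} (hΩ : IsCompact Ω) {m u e₀ : E} {L : ℝ} (hL : 0 < L) (hu : ‖u‖ = 1)
    (he₀ : e₀ ≠ 0) (hue₀ : inner ℝ u e₀ = 0)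
    (hseg : ∀ t : ℝ, |t| ≤ L → m + t • u ∈ interior Ω) :
    ∃ s > 0, ∃ t₀ : ℝ, |t₀| < L ∧ (∃ e : E, ‖e‖ = 1 ∧ inner ℝ u e = 0 ∧
        m + t₀ • u + (s * (L ^ 2 - t₀ ^ 2)) • e ∈ frontier Ω) ∧
      ∀ t : ℝ, |t| ≤ L → ∀ z : E, inner ℝ u z = 0 → ‖z‖ ≤ s * (L ^ 2 - t ^ 2) →
        m + t • u + z ∈ Ω := by
  set T : E → ℝ := fun x => inner ℝ u (x - m) with hT
  set Z : E → E := fun x => x - m - T x • u with hZ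
  have hTc : Continuous T := by fun_prop
  have hZc : Continuous Z := by fun_prop
  have hdec : ∀ x, x = m + T x • u + Z x := fun x => by simp [hZ]
  have hTv : ∀ (t : ℝ) (z : E), inner ℝ u z = 0 → T (m + t • u + z) = t := by
    intro t z hz
    have : m + t • u + z - m = t • u + z := by abel
    simp [hT, this, inner_add_right, inner_smul_right, hu, hz]
  have hZv : ∀ (t : ℝ) (z : E), inner ℝ u z = 0 → Z (m + t • u + z) = z := by
    intro t z hz
    simp only [hZ, hTv t z hz]; abel
  have hZu : ∀ x, inner ℝ u (Z x) = 0 := by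
    intro x
    simp [hZ, inner_sub_right, inner_smul_right, hu, hT]
  set K : Set E := frontier Ω ∩ {x | |T x| ≤ L} with hK
  have hfr : frontier Ω ⊆ Ω := hΩ.isClosed.frontier_subset
  have hKc : IsCompact K := (hΩ.of_isClosed_subset isClosed_frontier hfr).inter_right
    (isClosed_le (by fun_prop) continuous_const)
  have hZpos : ∀ x ∈ K, 0 < ‖Z x‖ := by
    intro x hx
    rw [norm_pos_iff]
    intro h0
    have h1 := hdec x
    rw [h0, add_zero] at h1
    have h2 := hseg (T x) hx.2
    rw [← h1] at h2
    exact hx.1.2 h2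
  have hcross : ∀ t : ℝ, |t| ≤ L → ∀ z : E, m + t • u + z ∉ Ω →
      ∃ θ ∈ Set.Icc (0 : ℝ) 1, m + t • u + θ • z ∈ frontier Ω := by
    intro t ht z hx
    obtain ⟨x', hx', hx'f⟩ : ∃ x' ∈ segment ℝ (m + t • u) (m + t • u + z), x' ∈ frontier Ω := by
      by_contra! hno
      obtain ⟨w, -, hw, hw'⟩ := (convex_segment (m + t • u) (m + t • u + z)).isPreconnected
        (interior Ω) Ωᶜ isOpen_interior hΩ.isClosed.isOpen_compl
        (fun w hw => by
          by_cases hwΩ : w ∈ Ω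
          · exact Or.inl (by_contra fun h => hno w hw ⟨subset_closure hwΩ, h⟩)
          · exact Or.inr hwΩ)
        ⟨_, left_mem_segment _ _ _, hseg t ht⟩ ⟨_, right_mem_segment _ _ _, hx⟩
      exact hw' (interior_subset hw)
    rw [segment_eq_image'] at hx'
    obtain ⟨θ, hθ, rfl⟩ := hx'
    exact ⟨θ, hθ, by simpa using hx'f⟩
  have hout : ∃ N : ℝ, m + (0 : ℝ) • u + N • e₀ ∉ Ω := by
    obtain ⟨M, hM⟩ := hΩ.isBounded.subset_closedBall m
    refine ⟨(|M| + 1) / ‖e₀‖, fun h => ?_⟩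
    have := hM h
    have h0 : ‖e₀‖ ≠ 0 := norm_ne_zero_iff.2 he₀
    rw [mem_closedBall_iff_norm] at this
    have h3 : m + (0 : ℝ) • u + ((|M| + 1) / ‖e₀‖) • e₀ - m = ((|M| + 1) / ‖e₀‖) • e₀ := by
      simp
    rw [h3, norm_smul, Real.norm_eq_abs, abs_of_nonneg (by positivity),
      div_mul_cancel₀ _ h0] at this
    linarith [le_abs_self M]
  obtain ⟨N, hN⟩ := hout
  obtain ⟨θ, -, hx₁⟩ := hcross 0 (by simpa using hL.le) _ hN
  rw [smul_smul] at hx₁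
  have hperp : inner ℝ u ((θ * N) • e₀) = 0 := by rw [inner_smul_right, hue₀, mul_zero]
  set x₁ := m + (0 : ℝ) • u + (θ * N) • e₀
  have hTx₁ : T x₁ = 0 := hTv 0 _ hperp
  have hx₁K : x₁ ∈ K := ⟨hx₁, by simpa [hTx₁] using hL.le⟩
  -- The critical `s` is the minimum of `‖Z‖ / (L² - T²)`. Maximizing the reciprocal avoids the zero
  -- denominator at `|T| = L`.
  obtain ⟨y, hyK, hymax⟩ := hKc.exists_isMaxOn (f := fun x => (L ^ 2 - T x ^ 2) / ‖Z x‖) ⟨_, hx₁K⟩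
    (ContinuousOn.div (by fun_prop) (by fun_prop) fun x hx => (hZpos x hx).ne')
  have hyZ := hZpos y hyK
  -- The frontier point `x₁` at height `0` makes the maximum positive, which keeps `y` off the end
  -- planes `|T| = L`.
  have hHpos : 0 < (L ^ 2 - T y ^ 2) / ‖Z y‖ := by
    refine lt_of_lt_of_le ?_ (hymax hx₁K)
    have := hZpos _ hx₁K
    simp only [hTx₁, ne_eq, OfNat.ofNat_ne_zero, not_false_eq_true, zero_pow, sub_zero]
    positivity
  have hLT : 0 < L ^ 2 - T y ^ 2 := by
    by_contra! h
    exact absurd hHpos (not_lt.2 (div_nonpos_of_nonpos_of_nonneg h hyZ.le))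
  set s := ‖Z y‖ / (L ^ 2 - T y ^ 2) with hs
  have hspos : 0 < s := by positivity
  refine ⟨s, hspos, T y, abs_lt_of_sq_lt_sq (by linarith) hL.le,
    ⟨‖Z y‖⁻¹ • Z y, ?_, ?_, ?_⟩, ?_⟩
  · rw [norm_smul, norm_inv, norm_norm, inv_mul_cancel₀ hyZ.ne']
  · rw [inner_smul_right, hZu, mul_zero]
  · rw [hs, div_mul_cancel₀ _ hLT.ne', smul_smul, mul_inv_cancel₀ hyZ.ne', one_smul, ← hdec]
    exact hyK.1
  · intro t ht z hz hzs
    by_contra hx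
    obtain ⟨θ, hθ, hf⟩ := hcross t ht z hx
    have hθz : inner ℝ u (θ • z) = 0 := by rw [inner_smul_right, hz, mul_zero]
    have hxK : m + t • u + θ • z ∈ K := ⟨hf, by simpa [hTv t _ hθz] using ht⟩
    have h1 := hymax hxK
    have h2 := hZpos _ hxK
    simp only [Set.mem_ofPred_eq, hTv t _ hθz, hZv t _ hθz] at h1 h2
    rw [div_le_div_iff₀ h2 hyZ] at h1
    have h3 : s * (L ^ 2 - t ^ 2) ≤ ‖θ • z‖ := by
      rw [hs, div_mul_eq_mul_div, div_le_iff₀ hLT]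
      linarith
    rw [norm_smul, Real.norm_eq_abs, abs_of_nonneg hθ.1] at h3 h2
    have hz0 : 0 < ‖z‖ := pos_of_mul_pos_right h2 hθ.1
    have hθ1 : 1 ≤ θ := le_of_mul_le_mul_right (by linarith) hz0
    have : θ = 1 := le_antisymm hθ.2 hθ1
    rw [this, one_smul] at hf
    exact hx (hfr hf)

/-! ### Inner and outer radii. -/

theorem outerRadius_nonneg {n : ℕ} (Ω : Set (EuclideanSpace ℝ (Fin n))) : 0 ≤ outerRadius Ω :=
  Real.sInf_nonneg fun _ h => h.1

theorem outerRadius_le {n : ℕ} {Ω : Set (EuclideanSpace ℝ (Fin n))} {ρ : ℝ} (hρ : 0 ≤ ρ)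
    {c : EuclideanSpace ℝ (Fin n)} (h : Ω ⊆ Metric.closedBall c ρ) : outerRadius Ω ≤ ρ :=
  csInf_le ⟨0, fun _ h => h.1⟩ ⟨hρ, c, h⟩

/-- The diameter bounds all admissible radii, so the supremum is genuine; in dimension `0` a point
contains balls of every radius. -/
theorem le_innerRadius {n : ℕ} (hn : 1 ≤ n) {Ω : Set (EuclideanSpace ℝ (Fin n))}
    (hΩ : Bornology.IsBounded Ω) {ρ : ℝ} (hρ : 0 ≤ ρ)
    {c : EuclideanSpace ℝ (Fin n)} (h : Metric.closedBall c ρ ⊆ Ω) : ρ ≤ innerRadius Ω := by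
  refine le_csSup ?_ ⟨hρ, c, h⟩
  refine ⟨Metric.diam Ω, ?_⟩
  rintro σ ⟨hσ, d, hd⟩
  let e : EuclideanSpace ℝ (Fin n) := EuclideanSpace.single ⟨0, hn⟩ 1
  have he : ‖e‖ = 1 := by simp [e]
  have hmem : d + σ • e ∈ Ω := hd (by simp [norm_smul, he, abs_of_nonneg hσ])
  have := Metric.dist_le_diam_of_mem hΩ hmem (hd (Metric.mem_closedBall_self hσ))
  simpa [norm_smul, he, abs_of_nonneg hσ] using this

theorem exists_ne_zero_inner_eq_zero {n : ℕ} (hn : 2 ≤ n) (u : EuclideanSpace ℝ (Fin n)) :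
    ∃ e : EuclideanSpace ℝ (Fin n), e ≠ 0 ∧ inner ℝ u e = 0 := by
  have h : (ℝ ∙ u)ᗮ ≠ ⊥ := by
    intro h
    rw [Submodule.orthogonal_eq_bot_iff] at h
    have h1 := finrank_span_le_card (R := ℝ) ({u} : Set (EuclideanSpace ℝ (Fin n)))
    rw [h, finrank_top, finrank_euclideanSpace_fin] at h1
    simp at h1
    omega
  obtain ⟨e, he, hne⟩ := Submodule.exists_mem_ne_zero_of_ne_bot h
  exact ⟨e, hne, Submodule.mem_orthogonal_singleton_iff_inner_right.1 he⟩

/-! ### Curvature at the touching point and size of the spindle. -/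

/-- If a parabola with leading coefficient `-s e` inside `Ω` touches the frontier at `y`, then some
principal curvature at `y` is at most `2 s`. -/
theorem exists_isPrincipalCurvature_le {n : ℕ} {Ω : Set (EuclideanSpace ℝ (Fin n))}
    (hΩ : HasSmoothBoundary Ω) {y a e : EuclideanSpace ℝ (Fin n)} (hy : y ∈ frontier Ω) {s : ℝ}
    (hs : 0 ≤ s) (ha : 1 ≤ ‖a‖) (he : ‖e‖ = 1)
    (hpar : ∀ᶠ τ in nhds (0 : ℝ), y + τ • a + τ ^ 2 • (-s) • e ∈ Ω) :
    ∃ κ ≤ 2 * s, IsPrincipalCurvature Ω y κ := by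
  obtain ⟨f, hf⟩ := hΩ y hy
  obtain ⟨hfy, hdf, U, hU, hyU, hfU, hΩU⟩ := id hf
  have hf2 : ContDiffAt ℝ 2 f y :=
    (hfU.contDiffAt (hU.mem_nhds hyU)).of_le ENat.LEInfty.out
  have hmax : IsLocalMax (fun τ : ℝ => f (y + τ • a + τ ^ 2 • (-s) • e)) 0 := by
    have hc : ContinuousAt (fun τ : ℝ => y + τ • a + τ ^ 2 • (-s) • e) 0 := by fun_prop
    have hUτ : ∀ᶠ τ in nhds (0 : ℝ), y + τ • a + τ ^ 2 • (-s) • e ∈ U :=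
      hc.eventually_mem (hU.mem_nhds (by simpa using hyU))
    filter_upwards [hUτ, hpar] with τ h1 h2
    simpa [hfy] using (hΩU _ h1).1 h2
  obtain ⟨hz, hle⟩ := second_order_along_parabola hf2 a _ hmax
  have hN : 0 < ‖fderiv ℝ f y‖ := norm_pos_iff.2 hdf
  have hde : fderiv ℝ f y e ≤ ‖fderiv ℝ f y‖ := by
    have := (le_abs_self _).trans ((fderiv ℝ f y).le_opNorm e)
    rwa [he, mul_one] at this
  have hQ : fderiv ℝ (fderiv ℝ f) y a a ≤ (2 * s * ‖fderiv ℝ f y‖) * ‖a‖ ^ 2 := by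
    rw [map_smul, smul_eq_mul] at hle
    have h1 := mul_le_mul_of_nonneg_left hde hs
    have h2 : 1 ≤ ‖a‖ ^ 2 := one_le_pow₀ ha
    have h3 : 0 ≤ s * ‖fderiv ℝ f y‖ := by positivity
    nlinarith
  have hsymm : IsSymmSndFDerivAt ℝ f y := hf2.isSymmSndFDerivAt (by simp)
  obtain ⟨v, hv, hv0, μ, hμ, hvw⟩ := exists_eigenvector_le (fderiv ℝ (fderiv ℝ f) y)
    (fun v w => hsymm v w) (LinearMap.ker (fderiv ℝ f y).toLinearMap) (v₀ := a) hz
    (by rintro rfl; simp at ha; linarith) hQ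
  refine ⟨μ / ‖fderiv ℝ f y‖, (div_le_iff₀ hN).2 hμ, f, hf, v, hv0, hv, fun w hw => ?_⟩
  rw [hvw w hw]
  ring

/-- A nontrivial compact strictly convex set contains, in its interior, the middle half of a
diameter. -/
theorem exists_diameter_segment {E : Type*} [NormedAddCommGroup E] [NormedSpace ℝ E]
    {Ω : Set E} (hΩ : IsCompact Ω) (hconv : StrictConvex ℝ Ω) (hnt : Ω.Nontrivial) :
    ∃ L > 0, ∃ m u : E, ‖u‖ = 1 ∧ (∀ x ∈ Ω, ∀ x' ∈ Ω, ‖x - x'‖ ≤ 4 * L) ∧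
      ∀ t : ℝ, |t| ≤ L → m + t • u ∈ interior Ω := by
  obtain ⟨⟨p, q⟩, ⟨hp, hq⟩, hpq⟩ := (hΩ.prod hΩ).exists_isMaxOn
    (hnt.nonempty.prod hnt.nonempty) (f := fun z : E × E => ‖z.1 - z.2‖) (by fun_prop)
  replace hp : p ∈ Ω := hp
  replace hq : q ∈ Ω := hq
  have hdist : ∀ x ∈ Ω, ∀ x' ∈ Ω, ‖x - x'‖ ≤ ‖p - q‖ := fun x hx x' hx' =>
    hpq (Set.mk_mem_prod hx hx')
  obtain ⟨x, hx, x', hx', hxx⟩ := hnt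
  have hpos : 0 < ‖p - q‖ :=
    (norm_pos_iff.2 (sub_ne_zero.2 hxx)).trans_le (hdist x hx x' hx')
  obtain ⟨L, hpL⟩ : ∃ L, ‖p - q‖ = 4 * L := ⟨‖p - q‖ / 4, by ring⟩
  have hL : 0 < L := by linarith
  refine ⟨L, hL, (1 / 2 : ℝ) • p + (1 / 2 : ℝ) • q, (4 * L)⁻¹ • (p - q), ?_, ?_, ?_⟩
  · rw [norm_smul, hpL, Real.norm_eq_abs, abs_of_nonneg (by positivity)]
    field_simp
  · rwa [hpL] at hdist
  · intro t ht
    have h2 : |t / (4 * L)| ≤ 1 / 4 := by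
      rw [abs_div, abs_of_pos (by positivity : 0 < 4 * L), div_le_iff₀ (by positivity)]
      linarith
    have h3 := abs_le.1 h2
    have : (1 / 2 : ℝ) • p + (1 / 2 : ℝ) • q + t • (4 * L)⁻¹ • (p - q)
        = (1 / 2 + t / (4 * L)) • p + (1 / 2 - t / (4 * L)) • q := by
      rw [div_eq_mul_inv t]; module
    rw [this]
    exact hconv hp hq (sub_ne_zero.1 (norm_pos_iff.1 hpos)) (by linarith) (by linarith) (by ring)

/-- A spindle of half-length `L` and half-width `s L² ≤ 2 L` contains a ball of radius
`s L² / 3`. -/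
theorem closedBall_subset_of_spindle_subset {E : Type*} [NormedAddCommGroup E]
    [InnerProductSpace ℝ E] {Ω : Set E} {m u : E} {L s : ℝ} (hL : 0 < L) (hs : 0 < s)
    (hu : ‖u‖ = 1) (hsL : s * L ≤ 2)
    (hspin : ∀ t : ℝ, |t| ≤ L → ∀ z : E, inner ℝ u z = 0 → ‖z‖ ≤ s * (L ^ 2 - t ^ 2) →
        m + t • u + z ∈ Ω) :
    Metric.closedBall m (s * L ^ 2 / 3) ⊆ Ω := by
  intro x hx
  rw [mem_closedBall_iff_norm] at hx
  obtain ⟨t, ht⟩ : ∃ t : ℝ, t = inner ℝ u (x - m) := ⟨_, rfl⟩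
  have ht1 : |t| ≤ ‖x - m‖ := by simpa [hu, ht] using abs_real_inner_le_norm u (x - m)
  have hz : inner ℝ u (x - m - t • u) = 0 := by
    rw [inner_sub_right, inner_smul_right, real_inner_self_eq_norm_sq, hu, ← ht]; ring
  have hpy : ‖x - m‖ ^ 2 = t ^ 2 + ‖x - m - t • u‖ ^ 2 := by
    rw [norm_sub_sq_real (x - m), inner_smul_right, real_inner_comm, ← ht, norm_smul, hu,
      Real.norm_eq_abs, mul_one, sq_abs]
    ring
  have hzn : ‖x - m - t • u‖ ≤ s * L ^ 2 / 3 :=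
    (pow_le_pow_iff_left₀ (norm_nonneg _) (norm_nonneg _) two_ne_zero).1
      (by linarith [sq_nonneg t]) |>.trans hx
  have hρ : s * L ^ 2 / 3 ≤ 2 / 3 * L := by
    linarith [mul_le_mul_of_nonneg_right hsL hL.le]
  have htL : |t| ≤ 2 / 3 * L := ht1.trans (hx.trans hρ)
  have ht2 : t ^ 2 ≤ (2 / 3 * L) ^ 2 := sq_le_sq' (abs_le.1 htL).1 (abs_le.1 htL).2
  -- Here `L² - t² ≥ 5/9 L²`, more than the `1/3 L²` needed.
  have hzs : s * L ^ 2 / 3 ≤ s * (L ^ 2 - t ^ 2) := by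
    have : s * (1 / 3 * L ^ 2) ≤ s * (L ^ 2 - t ^ 2) :=
      mul_le_mul_of_nonneg_left (by linarith [sq_nonneg L]) hs.le
    linarith
  have := hspin t (by linarith) _ hz (hzn.trans hzs)
  simpa using this

/-- In a smooth strictly convex body some principal curvature is at most `96 r / R²`. -/
theorem exists_small_principalCurvature {n : ℕ} (hn : 2 ≤ n)
    {Ω : Set (EuclideanSpace ℝ (Fin n))} (hΩ : IsSmoothStrictlyConvexBody Ω) :
    0 < innerRadius Ω ∧ ∃ y ∈ frontier Ω, ∃ κ, IsPrincipalCurvature Ω y κ ∧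
      κ * outerRadius Ω ^ 2 ≤ 96 * innerRadius Ω := by
  obtain ⟨x₀, hx₀⟩ := hΩ.nonempty_interior
  have hnt : Ω.Nontrivial := by
    obtain ⟨e₁, he₁, -⟩ := exists_ne_zero_inner_eq_zero hn (0 : EuclideanSpace ℝ (Fin n))
    have : Nontrivial (EuclideanSpace ℝ (Fin n)) := ⟨e₁, 0, he₁⟩
    refine Set.not_subsingleton_iff.1 fun h => ?_
    have h1 := interior_mono (h.eq_singleton_of_mem (interior_subset hx₀)).subset hx₀
    rwa [interior_singleton] at h1
  obtain ⟨L, hL, m, u, hu, hdist, hseg⟩ :=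
    exists_diameter_segment hΩ.isCompact hΩ.strictConvex hnt
  obtain ⟨e₀, he₀, hue₀⟩ := exists_ne_zero_inner_eq_zero hn u
  obtain ⟨s, hs, t₀, ht₀, ⟨e, he, hue, hy⟩, hspin⟩ :=
    exists_touching_spindle hΩ.isCompact hL hu he₀ hue₀ hseg
  have hline : ∀ t : ℝ, |t| ≤ L → ∀ c : ℝ, |c| ≤ s * (L ^ 2 - t ^ 2) →
      m + t • u + c • e ∈ Ω := fun t ht c hc =>
    hspin t ht _ (by rw [inner_smul_right, hue, mul_zero])
      (by rwa [norm_smul, he, Real.norm_eq_abs, mul_one])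
  -- Opposite points of the waist are `2 s L²` apart, at most the diameter `4 L`.
  have hsL : s * L ≤ 2 := by
    have h0 : |s * L ^ 2| = s * L ^ 2 := abs_of_nonneg (by positivity)
    have h1 := hline 0 (by simpa using hL.le) (s * L ^ 2) (by rw [h0]; simp)
    have h2 := hline 0 (by simpa using hL.le) (-(s * L ^ 2)) (by rw [abs_neg, h0]; simp)
    have h3 := hdist _ h1 _ h2
    have h4 : m + (0 : ℝ) • u + (s * L ^ 2) • e - (m + (0 : ℝ) • u + (-(s * L ^ 2)) • e)
        = (2 * s * L ^ 2) • e := by module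
    rw [h4, norm_smul, he, Real.norm_eq_abs, abs_of_nonneg (by positivity)] at h3
    have h5 : (s * L) * L ≤ 2 * L := by linarith
    exact le_of_mul_le_mul_right h5 hL
  have hr : s * L ^ 2 / 3 ≤ innerRadius Ω :=
    le_innerRadius (by omega) hΩ.isCompact.isBounded (by positivity)
      (closedBall_subset_of_spindle_subset hL hs hu hsL hspin)
  have ha : 1 ≤ ‖u + (-(2 * s * t₀)) • e‖ := by
    have : ‖u + (-(2 * s * t₀)) • e‖ ^ 2 = 1 + (2 * s * t₀) ^ 2 := by
      rw [norm_add_sq_real, inner_smul_right, hue, hu, norm_smul, he, Real.norm_eq_abs,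
        mul_one, sq_abs]
      ring
    exact (one_le_sq_iff₀ (norm_nonneg _)).1 (by linarith [sq_nonneg (2 * s * t₀)])
  -- Expansion of the profile `s (L² - t²)` at `t = t₀ + τ`: slope `-2 s t₀`, quadratic coefficient
  -- `-s`.
  have hpar : ∀ᶠ τ in nhds (0 : ℝ), m + t₀ • u + (s * (L ^ 2 - t₀ ^ 2)) • e
      + τ • (u + (-(2 * s * t₀)) • e) + τ ^ 2 • (-s) • e ∈ Ω := by
    have hlt : ∀ᶠ τ in nhds (0 : ℝ), |t₀ + τ| < L := by
      refine ContinuousAt.eventually_lt (by fun_prop) continuousAt_const ?_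
      simpa using ht₀
    filter_upwards [hlt] with τ hτ
    have h0 : 0 ≤ L ^ 2 - (t₀ + τ) ^ 2 := by
      have := sq_lt_sq' (abs_lt.1 hτ).1 (abs_lt.1 hτ).2
      linarith
    have h1 := hline (t₀ + τ) hτ.le (s * (L ^ 2 - (t₀ + τ) ^ 2))
      (abs_of_nonneg (by positivity)).le
    convert h1 using 1
    module
  obtain ⟨κ, hκ, hκc⟩ := exists_isPrincipalCurvature_le hΩ.smooth hy hs.le ha he hpar
  refine ⟨lt_of_lt_of_le (by positivity) hr, _, hy, κ, hκc, ?_⟩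
  have hR : outerRadius Ω ≤ 4 * L := by
    refine outerRadius_le (by positivity) (c := x₀) fun x hx => ?_
    rw [mem_closedBall_iff_norm]
    exact hdist x hx x₀ (interior_subset hx₀)
  have hR2 : outerRadius Ω ^ 2 ≤ (4 * L) ^ 2 := pow_le_pow_left₀ (outerRadius_nonneg Ω) hR 2
  calc κ * outerRadius Ω ^ 2 ≤ 2 * s * outerRadius Ω ^ 2 :=
        mul_le_mul_of_nonneg_right hκ (sq_nonneg _)
    _ ≤ 2 * s * (4 * L) ^ 2 := mul_le_mul_of_nonneg_left hR2 (by positivity)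
    _ = 96 * (s * L ^ 2 / 3) := by ring
    _ ≤ 96 * innerRadius Ω := by linarith

theorem lemma4p1 (n : ℕ) (hn : 2 ≤ n) (Ω : Set (EuclideanSpace ℝ (Fin n)))
    (hΩ : IsSmoothStrictlyConvexBody Ω) :
    (∃ y ∈ frontier Ω,
      ENNReal.ofReal (outerRadius Ω ^ 2 / (4 * √2 * (n : ℝ) ^ 6 * innerRadius Ω))
        ≤ maxPrincipalRadius Ω y) ∧
    ENNReal.ofReal (outerRadius Ω ^ 2 / innerRadius Ω)
      ≤ ENNReal.ofReal (4 * √2 * (n : ℝ) ^ 6) * ⨆ y ∈ frontier Ω, maxPrincipalRadius Ω y := by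
  obtain ⟨hr, y, hy, κ, hκ, hle⟩ := exists_small_principalCurvature hn hΩ
  have hC : 96 ≤ 4 * √2 * (n : ℝ) ^ 6 := by
    have h1 : (1 : ℝ) ≤ √2 := Real.one_le_sqrt.2 (by norm_num)
    have h2 : (2 : ℝ) ^ 6 ≤ (n : ℝ) ^ 6 := pow_le_pow_left₀ (by norm_num) (by exact_mod_cast hn) 6
    nlinarith
  set C := 4 * √2 * (n : ℝ) ^ 6
  have hC0 : 0 < C := by linarith
  have hmain : ENNReal.ofReal (outerRadius Ω ^ 2 / (C * innerRadius Ω))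
      ≤ maxPrincipalRadius Ω y := by
    -- The sign of `κ` is immaterial: `ENNReal.ofReal` truncates at `0`, where the inverse is `∞`.
    refine le_trans ?_ (le_iSup₂ κ hκ)
    rw [ENNReal.le_inv_iff_mul_le, ← ENNReal.ofReal_mul (by positivity), ENNReal.ofReal_le_one,
      div_mul_eq_mul_div, div_le_one (by positivity), mul_comm]
    exact hle.trans (mul_le_mul_of_nonneg_right hC hr.le)
  refine ⟨⟨y, hy, hmain⟩, ?_⟩
  have : outerRadius Ω ^ 2 / innerRadius Ω = C * (outerRadius Ω ^ 2 / (C * innerRadius Ω)) := by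
    field_simp
  rw [this, ENNReal.ofReal_mul hC0.le]
  gcongr
  exact hmain.trans (le_iSup₂ (f := fun y (_ : y ∈ frontier Ω) => maxPrincipalRadius Ω y) y hy)
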